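/- Let $K$ be a symmetric positive definite $p\times p$ matrix and let $\bm X_1,\bm X_2,\dots$ be independent random vectors with law $N_p(\bm 0,K^{-1})$. Let $V=\{1,\dots,p\}$, and let $G^*$ be the undirected graph on $V$ in which two distinct nodes $i,k$ are not adjacent if and only if the coordinates $x_i$ and $x_k$ of $\bm x\sim N_p(\bm 0,K^{-1})$ are conditionally independent given the remaining coordinates $\bm x_{V\setminus\{i,k\}}$. Fix $j\in V$ and let $\mathit{mb}^*\subseteq V\setminus\{j\}$, the true Markov blanket of $j$, be the set of neighbours of $j$ in $G^*$. For $n\ge 1$ let $\bm X$ be the $n\times p$ matrix with rows $\bm X_1^T,\dots,\bm X_n^T$ and $\bm S=\bm X^T\bm X$; for $A\subseteq V$ let $|\bm S_A|$ be the determinant of the submatrix of $\bm S$ with rows and columns in $A$ (equal to $1$ if $A=\emptyset$). For $\mathit{mb}\subseteq V\setminus\{j\}$ with $q=|\mathit{mb}|$ elements, define the local fractional marginal pseudo-likelihood (almost surely well defined for $n\ge q+1$) $$p(\bm X_j\mid \bm X_{\mathit{mb}})=\pi^{-\frac{n-1}{2}}\,\frac{\Gamma\left(\frac{n+q}{2}\right)}{\Gamma\left(\frac{q+1}{2}\right)}\,n^{-\frac{2q+1}{2}}\left(\frac{|\bm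 S_{\mathit{mb}\cup\{j\}}|}{|\bm S_{\mathit{mb}}|}\right)^{-\frac{n-1}{2}} .$$ Lemma 1 (Overestimation). Let $\mathit{mb}\subseteq V\setminus\{j\}$ be a strict superset of $\mathit{mb}^*$, and put $a=|\mathit{mb}|-|\mathit{mb}^*|>0$. Then, as $n\to\infty$, $$\log\frac{p(\bm X_j\mid \bm X_{\mathit{mb}^*})}{p(\bm X_j\mid \bm X_{\mathit{mb}})}\to\infty\quad\text{in probability, and moreover}\quad \log\frac{p(\bm X_j\mid \bm X_{\mathit{mb}^*})}{p(\bm X_j\mid \bm X_{\mathit{mb}})}=\frac a2\log n+O_p(1).$$ -/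

import Mathlib

open MeasureTheory ProbabilityTheory Filter Topology
open scoped ENNReal Matrix

noncomputable section

namespace GGM

/-- The coordinates of a vector other than the `i`-th and the `j`-th. -/
def rest {p : ℕ} (i j : Fin p) (x : EuclideanSpace ℝ (Fin p)) :
    {k : Fin p // k ≠ i ∧ k ≠ j} → ℝ :=
  fun k => x k

theorem measurable_rest {p : ℕ} (i j : Fin p) : Measurable (rest i j) := by
  unfold rest
  fun_prop

/-- For a random vector with law `ν`: the `i`-th and the `j`-th coordinates are conditionally
independent given all the remaining coordinates. -/
def PairCondIndep {p : ℕ} (ν : Measure (EuclideanSpace ℝ (Fin p))) [IsFiniteMeasure ν]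
    (i j : Fin p) : Prop :=
  CondIndepFun (MeasurableSpace.comap (rest i j) inferInstance) (measurable_rest i j).comap_le
    (fun x : EuclideanSpace ℝ (Fin p) => x i) (fun x : EuclideanSpace ℝ (Fin p) => x j) ν

theorem PairCondIndep.symm {p : ℕ} {ν : Measure (EuclideanSpace ℝ (Fin p))} [IsFiniteMeasure ν]
    {i j : Fin p} (h : PairCondIndep ν i j) : PairCondIndep ν j i := by
  have le : ∀ a b : Fin p, MeasurableSpace.comap (rest (p := p) a b) inferInstance
      ≤ MeasurableSpace.comap (rest (p := p) b a) inferInstance := by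
    intro a b
    let g : ({k : Fin p // k ≠ b ∧ k ≠ a} → ℝ) → ({k : Fin p // k ≠ a ∧ k ≠ b} → ℝ) :=
      fun y k => y ⟨k.1, k.2.2, k.2.1⟩
    have hg : Measurable g := by fun_prop
    have hcomp : rest (p := p) a b = g ∘ rest b a := rfl
    rw [hcomp, ← MeasurableSpace.comap_comp]
    exact MeasurableSpace.comap_mono hg.comap_le
  have key := le_antisymm (le i j) (le j i)
  have h' := CondIndepFun.symm h
  unfold PairCondIndep
  simpa only [key] using h'

/-- The undirected conditional independence graph of a random vector with law `ν`: two distinct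
nodes are not joined by an edge if and only if the corresponding coordinates are conditionally
independent given all the remaining coordinates. -/
def condIndepGraph {p : ℕ} (ν : Measure (EuclideanSpace ℝ (Fin p))) [IsFiniteMeasure ν] :
    SimpleGraph (Fin p) where
  Adj i j := i ≠ j ∧ ¬ PairCondIndep ν i j
  symm := ⟨fun _ _ h => ⟨h.1.symm, fun h' => h.2 h'.symm⟩⟩
  loopless := ⟨fun _ h => h.1 rfl⟩

open Classical in
/-- The Markov blanket of a node: the set of its neighbours in the conditional independence
graph. -/
def markovBlanket {p : ℕ} (ν : Measure (EuclideanSpace ℝ (Fin p))) [IsFiniteMeasure ν]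
    (j : Fin p) : Finset (Fin p) :=
  Finset.univ.filter fun i => (condIndepGraph ν).Adj j i

/-- The `n × p` data matrix whose rows are the first `n` observations. -/
def dataMatrix {p : ℕ} (n : ℕ) (x : ℕ → EuclideanSpace ℝ (Fin p)) : Matrix (Fin n) (Fin p) ℝ :=
  Matrix.of fun i k => x i k

/-- The unscaled sample covariance matrix `Xᵀ X` of the first `n` observations. -/
def scatter {p : ℕ} (n : ℕ) (x : ℕ → EuclideanSpace ℝ (Fin p)) : Matrix (Fin p) (Fin p) ℝ :=
  (dataMatrix n x)ᵀ * dataMatrix n x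

/-- The principal minor `|S_A|` (equal to `1` for `A = ∅`). -/
def minor {p : ℕ} (S : Matrix (Fin p) (Fin p) ℝ) (A : Finset (Fin p)) : ℝ :=
  (S.submatrix (fun a : A => (a : Fin p)) (fun a : A => (a : Fin p))).det

/-- The local fractional marginal pseudo-likelihood `p(X_j | X_mb)` of the node `j` with candidate
Markov blanket `mb`, computed from the first `n` observations. -/
def localFMPL {p : ℕ} (n : ℕ) (x : ℕ → EuclideanSpace ℝ (Fin p)) (j : Fin p)
    (mb : Finset (Fin p)) : ℝ :=
  Real.pi ^ (-(((n : ℝ) - 1) / 2))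
    * (Real.Gamma (((n : ℝ) + (mb.card : ℝ)) / 2) / Real.Gamma (((mb.card : ℝ) + 1) / 2))
    * (n : ℝ) ^ (-((2 * (mb.card : ℝ) + 1) / 2))
    * (minor (scatter n x) (insert j mb) / minor (scatter n x) mb) ^ (-(((n : ℝ) - 1) / 2))

/-- `Y n → ∞` in probability. -/
def TendstoInfInProbability {Ω : Type*} [MeasurableSpace Ω] (P : Measure Ω) (Y : ℕ → Ω → ℝ) :
    Prop :=
  ∀ M : ℝ, Tendsto (fun n => P {ω | M < Y n ω}) atTop (𝓝 1)

/-- `Y n = O_p(1)`: the sequence is bounded in probability. -/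
def BoundedInProbability {Ω : Type*} [MeasurableSpace Ω] (P : Measure Ω) (Y : ℕ → Ω → ℝ) :
    Prop :=
  ∀ ε : ℝ≥0∞, 0 < ε → ∃ M : ℝ, ∀ᶠ n in atTop, P {ω | M < |Y n ω|} ≤ ε

end GGM

end

/-! Conditional independence of `x_j` and `x_k` given the rest forces `K j k = 0`, so `w = K_j / K j
j` has `w j = 1` and is supported on `j` and its blanket. By `K * K⁻¹ = 1`, the residual `w ⬝ x` is
uncorrelated with every `x_k`, `k ≠ j`. For the scatter matrix `S` the entries of `S w` off `j` are
therefore centred i.i.d. sums, of size `O_p(√n)`.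

The ratio of minors for a candidate `A` is the minimum of the quadratic form of `S` over vectors
with `j`-th entry 1 supported on `insert j A`. The same `w` competes for the true blanket and for
any superset. As `S ≥ n c` with high probability, `minor_div_bounds` puts both minima within `O_p(n)
/ (n c) = O_p(1)` of the form at `w`. Both are at least `n c`, so their logarithms differ by
`O_p(1/n)`, and the factor `(n - 1)/2` leaves `O_p(1)`.

What remains is deterministic: the power of `n` contributes `a log n` and the Gamma factors `-(a/2)
log n + O(1)`. Divergence in probability follows from the expansion. -/

noncomputable section

namespace GGM

/-! ### Orthogonality relations for conditional expectations -/

section CondExp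

theorem integrable_mul_of_memLp_two {Ω : Type*} {mΩ : MeasurableSpace Ω} {μ : Measure Ω}
    {f g : Ω → ℝ} (hf : MemLp f 2 μ) (hg : MemLp g 2 μ) : Integrable (fun x => f x * g x) μ :=
  hf.integrable_mul hg

variable {Ω : Type*} {m mΩ : MeasurableSpace Ω} {μ : Measure Ω} [IsFiniteMeasure μ] {f g : Ω → ℝ}

/-- The residual of the conditional expectation is orthogonal to the square-integrable functions
that are measurable for the conditioning σ-algebra. -/
theorem integral_sub_condExp_mul_eq_zero (hm : m ≤ mΩ) (hf : MemLp f 2 μ) (hg : MemLp g 2 μ)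
    (hgm : StronglyMeasurable[m] g) :
    ∫ x, (f x - (μ[f|m]) x) * g x ∂μ = 0 := by
  have h1 : Integrable (f * g) μ := hf.integrable_mul hg
  have h2 : Integrable (μ[f|m] * g) μ := (hf.condExp one_le_two).integrable_mul hg
  have h3 : μ[f * g|m] =ᵐ[μ] μ[f|m] * g :=
    condExp_mul_of_stronglyMeasurable_right hgm h1 (hf.integrable one_le_two)
  have h4 : ∫ x, (f x - (μ[f|m]) x) * g x ∂μ = ∫ x, (f * g) x ∂μ - ∫ x, (μ[f|m] * g) x ∂μ := by
    rw [← integral_sub h1 h2]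
    congr 1 with x
    simp [sub_mul]
  rw [h4, ← integral_condExp hm (f := f * g), integral_congr_ae h3, sub_self]

/-- The conditional expectation of a product of conditionally independent square-integrable
functions is the product of the conditional expectations. -/
theorem condExp_mul_of_condIndepFun [StandardBorelSpace Ω] (hm : m ≤ mΩ) (hf : MemLp f 2 μ)
    (hg : MemLp g 2 μ) (hfm : Measurable f) (hgm : Measurable g) (h : CondIndepFun m hm f g μ) :
    μ[f * g|m] =ᵐ[μ] μ[f|m] * μ[g|m] := by
  have h0 := ae_of_ae_trim hm ((condIndepFun_iff_map_prod_eq_prod_map_map (hm' := hm) hfm hgm).1 h)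
  filter_upwards [h0, condExp_ae_eq_integral_condExpKernel hm (hf.integrable_mul hg),
    condExp_ae_eq_integral_condExpKernel hm (hf.integrable one_le_two),
    condExp_ae_eq_integral_condExpKernel hm (hg.integrable one_le_two)] with ω h1 h2 h3 h4
  have hi : IndepFun f g (condExpKernel μ m ω) := by
    rw [indepFun_iff_map_prod_eq_prod_map_map hfm.aemeasurable hgm.aemeasurable]
    rw [Kernel.map_apply _ (hfm.prodMk hgm), Kernel.prod_apply, Kernel.map_apply _ hfm,
      Kernel.map_apply _ hgm] at h1
    exact h1
  rw [Pi.mul_apply, h2, h3, h4]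
  exact hi.integral_mul_eq_mul_integral hfm.aestronglyMeasurable hgm.aestronglyMeasurable

/-- Both `f * g` and `μ[f|m] * g` have conditional expectation `μ[f|m] * μ[g|m]`. Here conditional
independence replaces measurability of `g` with respect to `m`. -/
theorem integral_sub_condExp_mul_eq_zero_of_condIndepFun [StandardBorelSpace Ω] (hm : m ≤ mΩ)
    (hf : MemLp f 2 μ) (hg : MemLp g 2 μ) (hfm : Measurable f) (hgm : Measurable g)
    (h : CondIndepFun m hm f g μ) :
    ∫ x, (f x - (μ[f|m]) x) * g x ∂μ = 0 := by
  have h1 : Integrable (f * g) μ := hf.integrable_mul hg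
  have h2 : Integrable (μ[f|m] * g) μ := (hf.condExp one_le_two).integrable_mul hg
  have h3 : μ[μ[f|m] * g|m] =ᵐ[μ] μ[f|m] * μ[g|m] :=
    condExp_mul_of_stronglyMeasurable_left stronglyMeasurable_condExp h2 (hg.integrable one_le_two)
  have h4 : ∫ x, (f x - (μ[f|m]) x) * g x ∂μ = ∫ x, (f * g) x ∂μ - ∫ x, (μ[f|m] * g) x ∂μ := by
    rw [← integral_sub h1 h2]
    congr 1 with x
    simp [sub_mul]
  rw [h4, ← integral_condExp hm (f := f * g), ← integral_condExp hm (f := μ[f|m] * g),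
    integral_congr_ae (condExp_mul_of_condIndepFun hm hf hg hfm hgm h), integral_congr_ae h3,
    sub_self]

end CondExp

/-! ### Conditional independence and zeros of the precision matrix -/

section Gaussian

variable {p : ℕ} {K : Matrix (Fin p) (Fin p) ℝ}

theorem memLp_coord (S : Matrix (Fin p) (Fin p) ℝ) (i : Fin p) (q : ℝ≥0∞) (hq : q ≠ ∞) :
    MemLp (fun x : EuclideanSpace ℝ (Fin p) => x i) q (multivariateGaussian 0 S) :=
  (IsGaussian.memLp_id (multivariateGaussian 0 S) q hq).continuousLinearMap_comp
    (EuclideanSpace.proj (𝕜 := ℝ) i)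

theorem integral_coord (S : Matrix (Fin p) (Fin p) ℝ) (i : Fin p) :
    ∫ x : EuclideanSpace ℝ (Fin p), x i ∂(multivariateGaussian 0 S) = 0 := by
  have h := (EuclideanSpace.proj (𝕜 := ℝ) i).integral_comp_comm
    (IsGaussian.integrable_id (μ := multivariateGaussian 0 S))
  simpa using h

theorem integral_coord_mul_coord {S : Matrix (Fin p) (Fin p) ℝ} (hS : S.PosSemidef)
    (i k : Fin p) :
    ∫ x : EuclideanSpace ℝ (Fin p), x i * x k ∂(multivariateGaussian 0 S) = S i k := by
  rw [← covariance_eval_multivariateGaussian (μ := 0) hS i k,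
    covariance_eq_sub (memLp_coord S i 2 (by simp)) (memLp_coord S k 2 (by simp)),
    integral_coord, integral_coord]
  simp

/-- The linear form `x ↦ (K x)ⱼ`. -/
def rowForm (K : Matrix (Fin p) (Fin p) ℝ) (j : Fin p) (x : EuclideanSpace ℝ (Fin p)) : ℝ :=
  ∑ k, K j k * x k

theorem measurable_rowForm (K : Matrix (Fin p) (Fin p) ℝ) (j : Fin p) :
    Measurable (rowForm K j) := by
  unfold rowForm
  fun_prop

theorem memLp_rowForm (S K : Matrix (Fin p) (Fin p) ℝ) (j : Fin p) (q : ℝ≥0∞) (hq : q ≠ ∞) :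
    MemLp (rowForm K j) q (multivariateGaussian 0 S) :=
  memLp_finsetSum _ fun k _ => (memLp_coord S k q hq).const_mul _

theorem integral_rowForm (S K : Matrix (Fin p) (Fin p) ℝ) (j : Fin p) :
    ∫ x, rowForm K j x ∂(multivariateGaussian 0 S) = 0 := by
  unfold rowForm
  rw [integral_finsetSum _ fun k _ =>
    ((memLp_coord S k 1 (by simp)).integrable le_rfl).const_mul _]
  simp [integral_const_mul, integral_coord]

theorem integral_rowForm_mul_coord (hK : K.PosDef) (j k : Fin p) :
    ∫ x, rowForm K j x * x k ∂(multivariateGaussian 0 K⁻¹) = if j = k then 1 else 0 := by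
  unfold rowForm
  simp_rw [Finset.sum_mul, mul_assoc]
  rw [integral_finsetSum _ fun l _ => (integrable_mul_of_memLp_two (memLp_coord _ l 2 (by simp))
    (memLp_coord _ k 2 (by simp))).const_mul _]
  simp_rw [integral_const_mul, integral_coord_mul_coord hK.inv.posSemidef]
  have h : K * K⁻¹ = 1 := Matrix.mul_nonsing_inv _ ((Matrix.isUnit_iff_isUnit_det _).1 hK.isUnit)
  have := congrFun (congrFun h j) k
  rwa [Matrix.mul_apply, Matrix.one_apply] at this

/-- The coordinates other than the `j`-th. -/
def others (j : Fin p) (x : EuclideanSpace ℝ (Fin p)) : {k : Fin p // k ≠ j} → ℝ := fun k => x k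

theorem measurable_others (j : Fin p) : Measurable (others (p := p) j) := by
  unfold others
  fun_prop

/-- The two are jointly Gaussian, being linear images of one Gaussian vector, and `K * K⁻¹ = 1`
makes their covariances vanish. -/
theorem indepFun_others_rowForm (hK : K.PosDef) (j : Fin p) :
    IndepFun (others j) (rowForm K j) (multivariateGaussian 0 K⁻¹) := by
  let L : EuclideanSpace ℝ (Fin p) →L[ℝ] (({k : Fin p // k ≠ j} → ℝ) × (Unit → ℝ)) :=
    (ContinuousLinearMap.pi fun k => EuclideanSpace.proj (𝕜 := ℝ) k.1).prod
      (ContinuousLinearMap.pi fun _ => ∑ k, K j k • EuclideanSpace.proj (𝕜 := ℝ) k)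
  have hL : ∀ x, L x = (fun k => x k.1, fun _ => rowForm K j x) := by
    intro x
    refine Prod.ext rfl ?_
    ext
    simp [L, rowForm]
  have hg : HasGaussianLaw (fun x : EuclideanSpace ℝ (Fin p) =>
      ((fun (k : {k : Fin p // k ≠ j}) => x k.1), fun (_ : Unit) => rowForm K j x))
      (multivariateGaussian 0 K⁻¹) := by
    have := (IsGaussian.hasGaussianLaw_id (μ := multivariateGaussian 0 K⁻¹)).map_fun L
    simpa only [id, hL] using this
  have h := HasGaussianLaw.indepFun_of_covariance_eval (κ := Unit)
    (X := fun (k : {k : Fin p // k ≠ j}) (x : EuclideanSpace ℝ (Fin p)) => x k.1)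
    (Y := fun _ x => rowForm K j x) hg (by
      intro k _
      rw [covariance_eq_sub (memLp_coord _ _ 2 (by simp)) (memLp_rowForm _ _ _ 2 (by simp)),
        integral_rowForm]
      have h := integral_rowForm_mul_coord hK j k
      simp only [mul_comm (rowForm K j _), k.2.symm, if_false] at h
      simpa using h)
  exact h.comp (φ := id) (ψ := fun f : Unit → ℝ => f ()) measurable_id (measurable_pi_apply ())

/-- Independence, not mere uncorrelatedness, is what permits nonlinear `u`; it will be applied to
conditional expectations, not known to be linear. -/
theorem integral_mul_rowForm_eq_zero (hK : K.PosDef) (j : Fin p)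
    {u : EuclideanSpace ℝ (Fin p) → ℝ}
    (hu : Measurable[MeasurableSpace.comap (others j) inferInstance] u) :
    ∫ x, u x * rowForm K j x ∂(multivariateGaussian 0 K⁻¹) = 0 := by
  have h : IndepFun u (rowForm K j) (multivariateGaussian 0 K⁻¹) := by
    have h1 := indepFun_others_rowForm hK j
    rw [IndepFun_iff_Indep] at h1 ⊢
    exact indep_of_indep_of_le_left h1 hu.comap_le
  rw [h.integral_fun_mul_eq_mul_integral
    (hu.mono (measurable_others j).comap_le le_rfl).aestronglyMeasurable
    (measurable_rowForm K j).aestronglyMeasurable, integral_rowForm, mul_zero]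

theorem comap_rest_le_left (i j : Fin p) :
    MeasurableSpace.comap (rest (p := p) i j) inferInstance
      ≤ MeasurableSpace.comap (others (p := p) i) inferInstance := by
  let g : ({k : Fin p // k ≠ i} → ℝ) → ({k : Fin p // k ≠ i ∧ k ≠ j} → ℝ) :=
    fun y k => y ⟨k.1, k.2.1⟩
  have hg : Measurable g := by fun_prop
  have hcomp : rest (p := p) i j = g ∘ others i := rfl
  rw [hcomp, ← MeasurableSpace.comap_comp]
  exact MeasurableSpace.comap_mono hg.comap_le

theorem comap_rest_le_right (i j : Fin p) :
    MeasurableSpace.comap (rest (p := p) i j) inferInstance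
      ≤ MeasurableSpace.comap (others (p := p) j) inferInstance := by
  let g : ({k : Fin p // k ≠ j} → ℝ) → ({k : Fin p // k ≠ i ∧ k ≠ j} → ℝ) :=
    fun y k => y ⟨k.1, k.2.2⟩
  have hg : Measurable g := by fun_prop
  have hcomp : rest (p := p) i j = g ∘ others j := rfl
  rw [hcomp, ← MeasurableSpace.comap_comp]
  exact MeasurableSpace.comap_mono hg.comap_le

/-- The entry of the precision matrix at a pair of coordinates that are conditionally independent
given the rest vanishes. -/
theorem precision_eq_zero_of_pairCondIndep (hK : K.PosDef) {i j : Fin p} (hij : i ≠ j)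
    (h : PairCondIndep (multivariateGaussian 0 K⁻¹) i j) : K j i = 0 := by
  set ν := multivariateGaussian (0 : EuclideanSpace ℝ (Fin p)) K⁻¹
  set m : MeasurableSpace (EuclideanSpace ℝ (Fin p)) :=
    MeasurableSpace.comap (rest i j) inferInstance with hmdef
  have hm := (measurable_rest i j).comap_le
  set f : EuclideanSpace ℝ (Fin p) → ℝ := fun x => x i with hf
  have hLp : ∀ k : Fin p, MemLp (fun x : EuclideanSpace ℝ (Fin p) => x k) 2 ν :=
    fun k => memLp_coord _ k 2 (by simp)
  have hcLp : MemLp (ν[f|m]) 2 ν := (hLp i).condExp one_le_two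
  set u : EuclideanSpace ℝ (Fin p) → ℝ := fun x => f x - (ν[f|m]) x with hu
  have huLp : MemLp u 2 ν := (hLp i).sub hcLp
  have hcm : StronglyMeasurable[m] (ν[f|m]) := stronglyMeasurable_condExp
  have hfj : Measurable[MeasurableSpace.comap (others j) inferInstance] f :=
    (measurable_pi_apply (⟨i, hij⟩ : {k : Fin p // k ≠ j})).comp (comap_measurable (others j))
  have huj : Measurable[MeasurableSpace.comap (others j) inferInstance] u :=
    hfj.sub (hcm.measurable.mono (comap_rest_le_right i j) le_rfl)
  have h1 : ∫ x, u x * rowForm K j x ∂ν = 0 := integral_mul_rowForm_eq_zero hK j huj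
  -- The residual `u` is orthogonal to `x_j` by conditional independence and to the other
  -- coordinates by conditioning, so only the term `k = i` of `rowForm K j` survives below.
  have hrest : ∀ k, k ≠ i → ∫ x, u x * x k ∂ν = 0 := by
    intro k hki
    by_cases hkj : k = j
    · subst hkj
      exact integral_sub_condExp_mul_eq_zero_of_condIndepFun hm (hLp i) (hLp k)
        (by fun_prop) (by fun_prop) h
    · refine integral_sub_condExp_mul_eq_zero hm (hLp i) (hLp k) ?_
      exact ((measurable_pi_apply (⟨k, hki, hkj⟩ : {k : Fin p // k ≠ i ∧ k ≠ j})).comp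
        (comap_measurable (rest i j))).stronglyMeasurable
  have h2 : K j i * ∫ x, u x * x i ∂ν = 0 := by
    rw [← h1]
    unfold rowForm
    simp_rw [Finset.mul_sum, mul_left_comm]
    rw [integral_finsetSum _ fun k _ => (integrable_mul_of_memLp_two huLp (hLp k)).const_mul _,
      Finset.sum_eq_single i]
    · rw [integral_const_mul]
    · intro k _ hk
      rw [integral_const_mul, hrest k hk, mul_zero]
    · simp
  -- If `u` were orthogonal to `x_i` it would vanish almost surely, yet its pairing with `rowForm K
  -- i` equals 1.
  refine (mul_eq_zero.1 h2).resolve_right fun h3 => ?_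
  have h4 : ∫ x, u x * u x ∂ν = 0 := by
    have h5 := integral_sub_condExp_mul_eq_zero hm (hLp i) hcLp hcm
    have h6 : ∫ x, u x * u x ∂ν = ∫ x, u x * x i ∂ν - ∫ x, u x * (ν[f|m]) x ∂ν := by
      rw [← integral_sub (integrable_mul_of_memLp_two huLp (hLp i))
        (integrable_mul_of_memLp_two huLp hcLp)]
      congr 1 with x
      simp only [hu, hf]
      ring
    rw [h6, h3]
    simpa [hu] using h5
  have h7 : u =ᵐ[ν] 0 := by
    have := (integral_eq_zero_iff_of_nonneg (fun x => mul_self_nonneg (u x))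
      (huLp.integrable_mul huLp)).1 h4
    filter_upwards [this] with x hx
    simpa using hx
  have h8 : ∫ x, u x * rowForm K i x ∂ν = 0 := by
    rw [integral_congr_ae (g := fun _ => 0)]
    · simp
    · filter_upwards [h7] with x hx
      simp [hx]
  have h9 : ∫ x, u x * rowForm K i x ∂ν
      = ∫ x, rowForm K i x * x i ∂ν - ∫ x, (ν[f|m]) x * rowForm K i x ∂ν := by
    rw [← integral_sub (integrable_mul_of_memLp_two (memLp_rowForm _ _ _ 2 (by simp)) (hLp i))
      (integrable_mul_of_memLp_two hcLp (memLp_rowForm _ _ _ 2 (by simp)))]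
    congr 1 with x
    simp only [hu, hf]
    ring
  rw [h8, integral_rowForm_mul_coord hK, integral_mul_rowForm_eq_zero hK i
    (hcm.measurable.mono (comap_rest_le_left i j) le_rfl)] at h9
  simp at h9

end Gaussian

/-! ### Growth of Gamma ratios -/

section LogGamma

theorem log_Gamma_add_one {x : ℝ} (hx : 0 < x) :
    Real.log (Real.Gamma (x + 1)) = Real.log (Real.Gamma x) + Real.log x := by
  rw [Real.Gamma_add_one hx.ne', Real.log_mul hx.ne' (Real.Gamma_pos_of_pos hx).ne', add_comm]

/-- Log-convexity of Gamma. Two consecutive half steps add up to `log x`, so the first is at most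
half of it and the second at least half. -/
theorem log_Gamma_half_steps_le {x : ℝ} (hx : 0 < x) :
    Real.log (Real.Gamma (x + 1 / 2)) - Real.log (Real.Gamma x)
      ≤ Real.log (Real.Gamma (x + 1)) - Real.log (Real.Gamma (x + 1 / 2)) := by
  have h := Real.convexOn_log_Gamma.slope_mono_adjacent (x := x) (y := x + 1 / 2) (z := x + 1)
    hx (by simp only [Set.mem_Ioi]; linarith) (by linarith) (by linarith)
  simp only [Function.comp] at h
  have e1 : x + 1 / 2 - x = 1 / 2 := by ring
  have e2 : x + 1 - (x + 1 / 2) = 1 / 2 := by ring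
  rw [e1, e2] at h
  linarith

theorem log_Gamma_add_half_sub_le {x : ℝ} (hx : 0 < x) :
    Real.log (Real.Gamma (x + 1 / 2)) - Real.log (Real.Gamma x) ≤ Real.log x / 2 := by
  linarith [log_Gamma_half_steps_le hx, log_Gamma_add_one hx]

theorem le_log_Gamma_add_half_sub {x : ℝ} (hx : 1 / 2 < x) :
    Real.log (x - 1 / 2) / 2 ≤ Real.log (Real.Gamma (x + 1 / 2)) - Real.log (Real.Gamma x) := by
  have h := log_Gamma_half_steps_le (x := x - 1 / 2) (by linarith)
  have h' := log_Gamma_add_one (x := x - 1 / 2) (by linarith)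
  have e1 : x - 1 / 2 + 1 / 2 = x := by ring
  have e2 : x - 1 / 2 + 1 = x + 1 / 2 := by ring
  rw [e1, e2] at h
  rw [e2] at h'
  linarith

theorem exists_abs_log_Gamma_half_step_le (q : ℕ) :
    ∃ B : ℝ, ∀ n : ℕ, 2 ≤ n →
      |Real.log (Real.Gamma (((n : ℝ) + ((q + 1 : ℕ) : ℝ)) / 2))
        - Real.log (Real.Gamma (((n : ℝ) + (q : ℝ)) / 2)) - Real.log n / 2| ≤ B := by
  -- The constants come from `(n + q)/2 ≤ n (q + 1)` and `(n + q)/2 - 1/2 ≥ n/4`; the latter uses `n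
  -- ≥ 2`.
  refine ⟨Real.log 4 / 2 + Real.log (q + 1) / 2, fun n hn => ?_⟩
  have hn' : (2 : ℝ) ≤ n := by exact_mod_cast hn
  have hq : (0 : ℝ) ≤ q := Nat.cast_nonneg q
  have e : ((n : ℝ) + ((q + 1 : ℕ) : ℝ)) / 2 = ((n : ℝ) + q) / 2 + 1 / 2 := by push_cast; ring
  rw [e]
  have hx : 1 / 2 < ((n : ℝ) + q) / 2 := by linarith
  have h1 := log_Gamma_add_half_sub_le (x := ((n : ℝ) + q) / 2) (by linarith)
  have h2 := le_log_Gamma_add_half_sub hx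
  have h3 : Real.log (((n : ℝ) + q) / 2) ≤ Real.log n + Real.log (q + 1) := by
    rw [← Real.log_mul (by positivity) (by positivity)]
    refine Real.log_le_log (by positivity) ?_
    nlinarith
  have h4 : Real.log n - Real.log 4 ≤ Real.log (((n : ℝ) + q) / 2 - 1 / 2) := by
    rw [← Real.log_div (by positivity) (by norm_num)]
    refine Real.log_le_log (by positivity) ?_
    linarith
  have h5 : 0 ≤ Real.log (q + 1) := Real.log_nonneg (by linarith)
  have h6 : 0 ≤ Real.log 4 := Real.log_nonneg (by norm_num)
  rw [abs_le]
  constructor <;> linarith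

theorem exists_abs_log_Gamma_sub_le (q a : ℕ) :
    ∃ B : ℝ, ∀ n : ℕ, 2 ≤ n →
      |Real.log (Real.Gamma (((n : ℝ) + ((q + a : ℕ) : ℝ)) / 2))
        - Real.log (Real.Gamma (((n : ℝ) + (q : ℝ)) / 2)) - a / 2 * Real.log n| ≤ B := by
  induction a with
  | zero => exact ⟨0, fun n _ => by simp⟩
  | succ a ih =>
    obtain ⟨B, hB⟩ := ih
    obtain ⟨C, hC⟩ := exists_abs_log_Gamma_half_step_le (q + a)
    refine ⟨B + C, fun n hn => ?_⟩
    have h := abs_add_le _ _ |>.trans (add_le_add (hB n hn) (hC n hn))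
    refine le_trans (le_of_eq ?_) h
    congr 1
    push_cast
    rw [← add_assoc (q : ℝ)]
    ring

end LogGamma

/-! ### Ratios of principal minors as minima of a quadratic form -/

section SchurComplement

variable {p : ℕ}

/-- The quadratic form of a matrix. -/
def quad (S : Matrix (Fin p) (Fin p) ℝ) (w : Fin p → ℝ) : ℝ := w ⬝ᵥ S *ᵥ w

theorem minor_pos {S : Matrix (Fin p) (Fin p) ℝ} (hS : S.PosDef) (A : Finset (Fin p)) :
    0 < minor S A :=
  (hS.submatrix Subtype.val_injective).det_pos

/-- Schur complement formula, after listing the index `j` last. -/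
theorem minor_insert {S : Matrix (Fin p) (Fin p) ℝ} (hS : S.PosDef) {j : Fin p}
    {A : Finset (Fin p)} (hj : j ∉ A) :
    minor S (insert j A) = minor S A * (S j j - (fun a : A => S j a) ⬝ᵥ
      (S.submatrix (fun a : A => (a : Fin p)) (fun a : A => (a : Fin p)))⁻¹ *ᵥ
        fun a : A => S a j) := by
  set M := S.submatrix (fun a : A => (a : Fin p)) (fun a : A => (a : Fin p)) with hM
  have hMdet : IsUnit M.det := (minor_pos hS A).ne'.isUnit
  let := M.invertibleOfIsUnitDet hMdet
  let e : ↥(insert j A) ≃ A ⊕ PUnit.{1} :=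
    (Finset.subtypeInsertEquivOption hj).trans (Equiv.optionEquivSumPUnit _)
  have h : (S.submatrix (fun a : ↥(insert j A) => (a : Fin p))
      (fun a : ↥(insert j A) => (a : Fin p))).submatrix
      e.symm e.symm = Matrix.fromBlocks M (Matrix.of fun a _ => S a j)
        (Matrix.of fun _ a => S j a) (Matrix.of fun _ _ => S j j) := by
    ext a b
    rcases a with a | a <;> rcases b with b | b <;> rfl
  rw [minor, ← Matrix.det_submatrix_equiv_self e.symm, h, Matrix.det_fromBlocks₁₁, minor]
  congr 1
  rw [Matrix.det_unique, Matrix.invOf_eq_nonsing_inv, Matrix.sub_apply, Matrix.mul_assoc]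
  rfl

/-- The ratio of consecutive principal minors of a positive definite matrix is the value of the
quadratic form at a vector `w` with `w j = 1`, supported on `insert j A`, whose image is orthogonal
to the coordinates in `A`. -/
theorem exists_quad_eq_minor_div {S : Matrix (Fin p) (Fin p) ℝ} (hS : S.PosDef) {j : Fin p}
    {A : Finset (Fin p)} (hj : j ∉ A) :
    ∃ w : Fin p → ℝ, w j = 1 ∧ (∀ k, k ≠ j → k ∉ A → w k = 0) ∧ (∀ k ∈ A, (S *ᵥ w) k = 0) ∧
      quad S w = minor S (insert j A) / minor S A := by
  rw [minor_insert hS hj, mul_div_cancel_left₀ _ (minor_pos hS A).ne']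
  set M := S.submatrix (fun a : A => (a : Fin p)) (fun a : A => (a : Fin p)) with hM
  have hMdet : IsUnit M.det := (minor_pos hS A).ne'.isUnit
  -- The coefficients of the regression of `j` on `A`; `w` is the residual vector `(-y, 1)`.
  set y := M⁻¹ *ᵥ fun a : A => S a j with hy
  have hMy : M *ᵥ y = fun a : A => S a j := by
    rw [hy, Matrix.mulVec_mulVec, Matrix.mul_nonsing_inv _ hMdet, Matrix.one_mulVec]
  let w : Fin p → ℝ := fun k => if h : k ∈ A then -y ⟨k, h⟩ else if k = j then 1 else 0
  have hwj : w j = 1 := by simp [w, hj]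
  have hw0 : ∀ k, k ≠ j → k ∉ A → w k = 0 := by
    intro k h1 h2
    simp [w, h1, h2]
  have hwA : ∀ a : A, w a = -y a := by
    intro a
    simp [w]
  have hSw : ∀ k, (S *ᵥ w) k = S k j - ∑ a : A, S k a * y a := by
    intro k
    have hsub : ∑ l, S k l * w l = ∑ l ∈ insert j A, S k l * w l := by
      symm
      refine Finset.sum_subset (Finset.subset_univ _) fun l _ hl => ?_
      rw [Finset.mem_insert, not_or] at hl
      rw [hw0 l hl.1 hl.2, mul_zero]
    rw [Matrix.mulVec, dotProduct, hsub, Finset.sum_insert hj, hwj, mul_one,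
      ← Finset.sum_coe_sort A, sub_eq_add_neg, ← Finset.sum_neg_distrib]
    simp only [hwA, mul_neg]
  have hSwA : ∀ k ∈ A, (S *ᵥ w) k = 0 := by
    intro k hk
    rw [hSw, sub_eq_zero]
    exact (congrFun hMy ⟨k, hk⟩).symm
  refine ⟨w, hwj, hw0, hSwA, ?_⟩
  rw [quad, dotProduct, Finset.sum_eq_single j, hwj, one_mul, hSw]
  · rfl
  · intro k _ hk
    by_cases hkA : k ∈ A
    · rw [hSwA k hkA, mul_zero]
    · rw [hw0 k hk hkA, zero_mul]
  · simp

/-- Perturbation bound for the ratio of consecutive principal minors: if the quadratic form of `S`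
is at least `c` times the squared Euclidean norm, then the ratio is at least `c`, and it differs
little from the value of the form at an almost optimal `w`. -/
theorem minor_div_bounds {S : Matrix (Fin p) (Fin p) ℝ} (hS : S.PosDef) {c : ℝ} (hc : 0 < c)
    (hquad : ∀ w, c * ∑ k, w k ^ 2 ≤ quad S w) {j : Fin p} {A : Finset (Fin p)} (hj : j ∉ A)
    {w : Fin p → ℝ} (hwj : w j = 1) (hw : ∀ k, k ≠ j → k ∉ A → w k = 0) {V : ℝ}
    (hV : ∑ k ∈ Finset.univ.erase j, (S *ᵥ w) k ^ 2 ≤ V) :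
    c ≤ minor S (insert j A) / minor S A ∧ minor S (insert j A) / minor S A ≤ quad S w ∧
      quad S w - V / c ≤ minor S (insert j A) / minor S A := by
  obtain ⟨v, hvj, hv, hvA, hvR⟩ := exists_quad_eq_minor_div hS hj
  rw [← hvR]
  have hsymm : ∀ a b : Fin p → ℝ, a ⬝ᵥ S *ᵥ b = b ⬝ᵥ S *ᵥ a := by
    intro a b
    have hT : Sᵀ = S := by simpa [Matrix.IsSymm] using hS.isHermitian
    rw [Matrix.dotProduct_mulVec, ← Matrix.mulVec_transpose, hT, dotProduct_comm]
  set d : Fin p → ℝ := w - v with hd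
  have hdj : d j = 0 := by simp [hd, hwj, hvj]
  have hd0 : ∀ k, k ∉ A → d k = 0 := by
    intro k hk
    by_cases hkj : k = j
    · rw [hkj, hdj]
    · simp [hd, hw k hkj hk, hv k hkj hk]
  have hdv : d ⬝ᵥ S *ᵥ v = 0 := by
    refine Finset.sum_eq_zero fun k _ => ?_
    by_cases hk : k ∈ A
    · rw [hvA k hk, mul_zero]
    · rw [hd0 k hk, zero_mul]
  have hwvd : w = v + d := by simp [hd]
  -- Pythagoras: `v` is the minimiser and `d` is `S`-orthogonal to it, so the excess of `w` is
  -- exactly `quad S d`.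
  have hexp : quad S w = quad S v + quad S d := by
    simp only [quad, hwvd, Matrix.mulVec_add, add_dotProduct, dotProduct_add]
    rw [hsymm v d, hdv]
    ring
  have hdw : quad S d = d ⬝ᵥ S *ᵥ w := by
    rw [hwvd, Matrix.mulVec_add, dotProduct_add, hdv, zero_add, quad]
  -- Since `quad S d = d ⬝ᵥ S *ᵥ w`, completing the square gives `2 quad S d ≤ c ‖d‖² + V / c`; then
  -- `c ‖d‖² ≤ quad S d` is absorbed on the left.
  have hle : 2 * (d ⬝ᵥ S *ᵥ w) ≤ c * ∑ k, d k ^ 2 + V / c := by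
    have h1 : d ⬝ᵥ S *ᵥ w = ∑ k ∈ Finset.univ.erase j, d k * (S *ᵥ w) k := by
      rw [dotProduct, ← Finset.add_sum_erase _ _ (Finset.mem_univ j), hdj, zero_mul, zero_add]
    have h2 : ∑ k, d k ^ 2 = ∑ k ∈ Finset.univ.erase j, d k ^ 2 := by
      rw [← Finset.add_sum_erase _ _ (Finset.mem_univ j), hdj]
      simp
    have h3 : (∑ k ∈ Finset.univ.erase j, (S *ᵥ w) k ^ 2) / c ≤ V / c := by gcongr
    refine le_trans ?_ (add_le_add_right h3 _)
    rw [h1, h2, Finset.mul_sum, Finset.mul_sum, Finset.sum_div, ← Finset.sum_add_distrib]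
    refine Finset.sum_le_sum fun k _ => ?_
    rw [← sub_nonneg]
    have : c * d k ^ 2 + (S *ᵥ w) k ^ 2 / c - 2 * (d k * (S *ᵥ w) k)
        = (c * d k - (S *ᵥ w) k) ^ 2 / c := by
      field_simp
      ring
    rw [this]
    positivity
  have hdd := hquad d
  have hpos : 0 ≤ c * ∑ k, d k ^ 2 := by positivity
  refine ⟨le_trans ?_ (hquad v), by linarith, by linarith⟩
  have h1 : (1 : ℝ) ≤ ∑ k, v k ^ 2 := by
    have := Finset.single_le_sum (f := fun k => v k ^ 2) (fun k _ => sq_nonneg _)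
      (Finset.mem_univ j)
    simpa [hvj] using this
  nlinarith

/-- A positive definite matrix dominates a positive multiple of the identity. -/
theorem exists_le_quad {S : Matrix (Fin p) (Fin p) ℝ} (hS : S.PosDef) :
    ∃ c : ℝ, 0 < c ∧ ∀ w, c * ∑ k, w k ^ 2 ≤ quad S w := by
  have hdet : IsUnit S.det := hS.det_pos.ne'.isUnit
  have hz : ∀ k, 0 < S⁻¹ k k := fun k => hS.inv.diag_pos
  -- Cauchy–Schwarz in the inner product of `S`, where `w k` is the pairing of `w` with `z = S⁻¹
  -- e_k`.
  have hcoord : ∀ w k, w k ^ 2 ≤ S⁻¹ k k * quad S w := by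
    intro w k
    set z : Fin p → ℝ := S⁻¹ *ᵥ Pi.single k 1 with hzdef
    have hSz : S *ᵥ z = Pi.single k 1 := by
      rw [hzdef, Matrix.mulVec_mulVec, Matrix.mul_nonsing_inv _ hdet, Matrix.one_mulVec]
    have hzk : z k = S⁻¹ k k := by simp [hzdef]
    have hT : Sᵀ = S := by simpa [Matrix.IsSymm] using hS.isHermitian
    have hzw : z ⬝ᵥ S *ᵥ w = w k := by
      rw [Matrix.dotProduct_mulVec, ← Matrix.mulVec_transpose, hT, hSz]
      simp
    have h0 : 0 ≤ quad S (S⁻¹ k k • w - w k • z) := by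
      simpa [quad] using hS.posSemidef.dotProduct_mulVec_nonneg (S⁻¹ k k • w - w k • z)
    have h1 : quad S (S⁻¹ k k • w - w k • z)
        = S⁻¹ k k * (S⁻¹ k k * quad S w - w k ^ 2) := by
      simp only [quad, Matrix.mulVec_sub, Matrix.mulVec_smul, sub_dotProduct, dotProduct_sub,
        smul_dotProduct, dotProduct_smul, hSz, hzw, dotProduct_single_one,
        Pi.sub_apply, Pi.smul_apply, hzk, smul_eq_mul]
      ring
    rw [h1] at h0
    linarith [nonneg_of_mul_nonneg_right h0 (hz k)]
  have hsum : ∀ w, ∑ k, w k ^ 2 ≤ (∑ k, S⁻¹ k k) * quad S w := fun w => by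
    rw [Finset.sum_mul]
    exact Finset.sum_le_sum fun k _ => hcoord w k
  have ht : 0 ≤ ∑ k, S⁻¹ k k := Finset.sum_nonneg fun k _ => (hz k).le
  -- The added 1 keeps the denominator positive even if `p = 0`.
  refine ⟨1 / (∑ k, S⁻¹ k k + 1), by positivity, fun w => ?_⟩
  have hq : 0 ≤ quad S w := by
    simpa [quad] using hS.posSemidef.dotProduct_mulVec_nonneg w
  rw [one_div, inv_mul_le_iff₀ (by positivity)]
  linarith [hsum w]

/-- Entrywise perturbation of a matrix changes the quadratic form little. -/
theorem le_quad_of_abs_sub_le {S T : Matrix (Fin p) (Fin p) ℝ} {c δ : ℝ}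
    (hS : ∀ w, c * ∑ k, w k ^ 2 ≤ quad S w) (hT : ∀ k l, |T k l - S k l| ≤ δ)
    (w : Fin p → ℝ) : (c - p * δ) * ∑ k, w k ^ 2 ≤ quad T w := by
  have h1 : quad S w - quad T w ≤ p * δ * ∑ k, w k ^ 2 := by
    have e : quad S w - quad T w = ∑ k, ∑ l, (S k l - T k l) * (w k * w l) := by
      simp only [quad, dotProduct, Matrix.mulVec, Finset.mul_sum, ← Finset.sum_sub_distrib]
      refine Finset.sum_congr rfl fun k _ => Finset.sum_congr rfl fun l _ => ?_
      ring
    have e2 : p * δ * ∑ k, w k ^ 2 = ∑ k : Fin p, ∑ l : Fin p, δ * ((w k ^ 2 + w l ^ 2) / 2) := by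
      simp only [← Finset.mul_sum, ← Finset.sum_div, Finset.sum_add_distrib, Finset.sum_const,
        Finset.card_univ, Fintype.card_fin, nsmul_eq_mul]
      ring
    rw [e, e2]
    refine Finset.sum_le_sum fun k _ => Finset.sum_le_sum fun l _ => ?_
    have h := abs_le.1 (hT k l)
    have hδ : 0 ≤ δ := (abs_nonneg _).trans (hT k l)
    have h2 : (S k l - T k l) * (w k * w l) ≤ |S k l - T k l| * |w k * w l| := by
      rw [← abs_mul]
      exact le_abs_self _
    refine h2.trans (mul_le_mul (by rw [abs_sub_comm]; exact hT k l) ?_ (abs_nonneg _) hδ)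
    rw [abs_le]
    constructor <;> nlinarith [sq_nonneg (w k + w l), sq_nonneg (w k - w l)]
  linarith [hS w, sub_mul c (p * δ) (∑ k, w k ^ 2)]

end SchurComplement

/-! ### Stochastic order of i.i.d. sums -/

section Probability

variable {Ω : Type*} [MeasurableSpace Ω] {P : Measure Ω}

/-- Sums of centred square-integrable i.i.d. variables are of order `√n` in probability. -/
theorem exists_measure_sqrt_le_abs_sum_le [IsProbabilityMeasure P] {E : Type*}
    [MeasurableSpace E] {ν : Measure E} [IsProbabilityMeasure ν] {X : ℕ → Ω → E}
    (hlaw : ∀ i, HasLaw (X i) ν P) (hindep : iIndepFun X P)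
    {g : E → ℝ} (hgm : Measurable g) (hg : MemLp g 2 ν) (hg0 : ∫ x, g x ∂ν = 0) {ε : ℝ≥0∞}
    (hε : 0 < ε) :
    ∃ T : ℝ, ∀ n : ℕ, 1 ≤ n →
      P {ω | T * √n ≤ |∑ i ∈ Finset.range n, g (X i ω)|} ≤ ε := by
  rcases eq_or_ne ε ∞ with rfl | hε'
  · exact ⟨0, fun n _ => le_top⟩
  have he : 0 < ε.toReal := ENNReal.toReal_pos hε.ne' hε'
  have hv : 0 ≤ Var[g; ν] := variance_nonneg _ _
  have hLp : ∀ i, MemLp (fun ω => g (X i ω)) 2 P := by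
    intro i
    have h := hg
    rw [← (hlaw i).map_eq] at h
    exact (memLp_map_measure_iff h.aestronglyMeasurable (hlaw i).aemeasurable).1 h
  have hmean : ∀ i, ∫ ω, g (X i ω) ∂P = 0 := by
    intro i
    rw [← hg0]
    exact (hlaw i).integral_comp hgm.aestronglyMeasurable
  have hvar : ∀ i, Var[fun ω => g (X i ω); P] = Var[g; ν] := by
    intro i
    rw [← (hlaw i).map_eq, variance_map (hgm.aemeasurable) (hlaw i).aemeasurable]
    rfl
  -- Chebyshev at level `T * √n` gives `Var / T²`; as `T ≥ 1`, it suffices that `Var ≤ ε T`.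
  set T : ℝ := Var[g; ν] / ε.toReal + 1 with hT
  have hT1 : 1 ≤ T := by
    rw [hT]
    have : 0 ≤ Var[g; ν] / ε.toReal := by positivity
    linarith
  refine ⟨T, fun n hn => ?_⟩
  have hn' : (0 : ℝ) < n := by exact_mod_cast hn
  have hsumLp : MemLp (∑ i ∈ Finset.range n, fun ω => g (X i ω)) 2 P :=
    memLp_finsetSum' _ fun i _ => hLp i
  have h := meas_ge_le_variance_div_sq hsumLp (c := T * √n) (by positivity)
  have hm : ∫ ω, (∑ i ∈ Finset.range n, fun ω => g (X i ω)) ω ∂P = 0 := by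
    simp_rw [Finset.sum_apply]
    rw [integral_finsetSum _ fun i _ => (hLp i).integrable one_le_two]
    exact Finset.sum_eq_zero fun i _ => hmean i
  have hV : Var[∑ i ∈ Finset.range n, fun ω => g (X i ω); P] = n * Var[g; ν] := by
    rw [IndepFun.variance_sum (fun i _ => hLp i)]
    · simp [hvar]
    · intro i _ k _ hik
      exact (hindep.indepFun hik).comp hgm hgm
  rw [hm, hV] at h
  simp only [sub_zero, Finset.sum_apply] at h
  refine h.trans (ENNReal.ofReal_le_of_le_toReal ?_)
  rw [mul_pow, Real.sq_sqrt hn'.le, mul_comm (T ^ 2), mul_div_mul_left _ _ hn'.ne',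
    div_le_iff₀ (by positivity)]
  have h1 : Var[g; ν] ≤ ε.toReal * T := by
    rw [hT, mul_add, mul_div_cancel₀ _ he.ne']
    linarith
  nlinarith

/-- A union bound, with `ε` shared equally among the indices. -/
theorem exists_uniform_measure_sqrt_le_abs_le {ι : Type*} [Fintype ι] {Z : ι → ℕ → Ω → ℝ}
    (h : ∀ i, ∀ ε : ℝ≥0∞, 0 < ε → ∃ T : ℝ, ∀ n : ℕ, 1 ≤ n → P {ω | T * √n ≤ |Z i n ω|} ≤ ε)
    {ε : ℝ≥0∞} (hε : 0 < ε) :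
    ∃ T : ℝ, 0 ≤ T ∧ ∀ n : ℕ, 1 ≤ n → P {ω | ∃ i, T * √n ≤ |Z i n ω|} ≤ ε := by
  have hε' : 0 < ε / (Fintype.card ι : ℝ≥0∞) :=
    ENNReal.div_pos hε.ne' (ENNReal.natCast_ne_top _)
  choose T hT using fun i => h i _ hε'
  refine ⟨∑ i, |T i|, Finset.sum_nonneg fun i _ => abs_nonneg _, fun n hn => ?_⟩
  have hsub : {ω | ∃ i, (∑ i, |T i|) * √n ≤ |Z i n ω|} ⊆ ⋃ i, {ω | T i * √n ≤ |Z i n ω|} := by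
    rintro ω ⟨i, hi⟩
    refine Set.mem_iUnion.2 ⟨i, le_trans ?_ hi⟩
    gcongr
    exact (le_abs_self _).trans
      (Finset.single_le_sum (f := fun i => |T i|) (fun i _ => abs_nonneg _) (Finset.mem_univ i))
  refine (measure_mono hsub).trans ((measure_iUnion_fintype_le _ _).trans ?_)
  refine (Finset.sum_le_sum fun i _ => hT i n hn).trans ?_
  rw [Finset.sum_const, Finset.card_univ, nsmul_eq_mul]
  exact ENNReal.mul_div_le

/-- Once `b n > M + B`, the event `Y n ≤ M` forces a deviation from `b n` larger than `B`. -/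
theorem tendstoInfInProbability_of_boundedInProbability_sub [IsProbabilityMeasure P]
    {Y : ℕ → Ω → ℝ} {b : ℕ → ℝ} (hb : Tendsto b atTop atTop)
    (h : BoundedInProbability P fun n ω => Y n ω - b n) :
    TendstoInfInProbability P Y := by
  intro M
  rw [tendsto_order]
  refine ⟨fun a ha => ?_, fun a ha => Eventually.of_forall fun n => prob_le_one.trans_lt ha⟩
  have hε : 0 < (1 - a) / 2 := ENNReal.div_pos (tsub_pos_of_lt ha).ne' (by simp)
  obtain ⟨B, hB⟩ := h _ hε
  filter_upwards [hB, hb.eventually_gt_atTop (M + B)] with n hn hbn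
  by_contra hcon
  rw [not_lt] at hcon
  have hcover : (Set.univ : Set Ω) ⊆ {ω | M < Y n ω} ∪ {ω | B < |Y n ω - b n|} := by
    intro ω _
    by_contra hω
    simp only [Set.mem_union, Set.mem_ofPred_eq, not_or, not_lt] at hω
    have := (abs_le.1 hω.2).1
    linarith [hω.1]
  have h1 : (1 : ℝ≥0∞) ≤ a + (1 - a) / 2 := by
    rw [← measure_univ (μ := P)]
    exact (measure_mono hcover).trans ((measure_union_le _ _).trans
      (by rw [measure_univ]; exact add_le_add hcon hn))
  have ha' : a ≠ ∞ := ha.ne_top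
  have h2 : a + (1 - a) / 2 < a + (1 - a) :=
    ENNReal.add_lt_add_left ha' (ENNReal.half_lt_self (tsub_pos_of_lt ha).ne'
      (ENNReal.sub_ne_top ENNReal.one_ne_top))
  rw [add_tsub_cancel_of_le ha.le] at h2
  exact absurd h1 (not_le.2 h2)

end Probability

/-! ### Deterministic comparison of two likelihoods -/

section Likelihood

variable {p : ℕ}

theorem scatter_apply (n : ℕ) (x : ℕ → EuclideanSpace ℝ (Fin p)) (k l : Fin p) :
    scatter n x k l = ∑ i ∈ Finset.range n, x i k * x i l := by
  rw [scatter, Matrix.mul_apply, ← Fin.sum_univ_eq_sum_range (fun i => x i k * x i l)]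
  rfl

theorem scatter_mulVec_apply (n : ℕ) (x : ℕ → EuclideanSpace ℝ (Fin p)) (w : Fin p → ℝ)
    (k : Fin p) :
    (scatter n x *ᵥ w) k = ∑ i ∈ Finset.range n, x i k * ∑ l, w l * x i l := by
  simp only [Matrix.mulVec, dotProduct, scatter_apply, Finset.sum_mul, Finset.mul_sum]
  rw [Finset.sum_comm]
  refine Finset.sum_congr rfl fun i _ => Finset.sum_congr rfl fun l _ => ?_
  ring

theorem scatter_posDef {n : ℕ} {x : ℕ → EuclideanSpace ℝ (Fin p)} {c : ℝ} (hc : 0 < c)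
    (h : ∀ w, c * ∑ k, w k ^ 2 ≤ quad (scatter n x) w) : (scatter n x).PosDef := by
  refine Matrix.PosDef.of_dotProduct_mulVec_pos ?_ fun w hw => ?_
  · exact Matrix.isHermitian_conjTranspose_mul_self (dataMatrix n x)
  · have hpos : 0 < ∑ k, w k ^ 2 := by
      obtain ⟨k, hk⟩ := Function.ne_iff.1 hw
      exact Finset.sum_pos' (fun _ _ => sq_nonneg _) ⟨k, Finset.mem_univ k, by
        simpa using pow_pos (abs_pos.2 hk) 2⟩
    have := (mul_pos hc hpos).trans_le (h w)
    simpa [quad] using this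

theorem localFMPL_pos {n : ℕ} (hn : 1 ≤ n) {x : ℕ → EuclideanSpace ℝ (Fin p)} {j : Fin p}
    {A : Finset (Fin p)} (hR : 0 < minor (scatter n x) (insert j A) / minor (scatter n x) A) :
    0 < localFMPL n x j A := by
  have hn' : (0 : ℝ) < n := by exact_mod_cast hn
  have h1 : 0 < Real.Gamma (((n : ℝ) + (A.card : ℝ)) / 2) := Real.Gamma_pos_of_pos (by positivity)
  have h2 : 0 < Real.Gamma (((A.card : ℝ) + 1) / 2) := Real.Gamma_pos_of_pos (by positivity)
  have hpi := Real.pi_pos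
  unfold localFMPL
  positivity

theorem log_localFMPL {n : ℕ} (hn : 1 ≤ n) {x : ℕ → EuclideanSpace ℝ (Fin p)} {j : Fin p}
    {A : Finset (Fin p)} (hR : 0 < minor (scatter n x) (insert j A) / minor (scatter n x) A) :
    Real.log (localFMPL n x j A) = -(((n : ℝ) - 1) / 2) * Real.log Real.pi
      + (Real.log (Real.Gamma (((n : ℝ) + (A.card : ℝ)) / 2))
        - Real.log (Real.Gamma (((A.card : ℝ) + 1) / 2)))
      - (2 * (A.card : ℝ) + 1) / 2 * Real.log n
      - ((n : ℝ) - 1) / 2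
        * Real.log (minor (scatter n x) (insert j A) / minor (scatter n x) A) := by
  have hn' : (0 : ℝ) < n := by exact_mod_cast hn
  have h1 : 0 < Real.Gamma (((n : ℝ) + (A.card : ℝ)) / 2) := Real.Gamma_pos_of_pos (by positivity)
  have h2 : 0 < Real.Gamma (((A.card : ℝ) + 1) / 2) := Real.Gamma_pos_of_pos (by positivity)
  have hpi := Real.pi_pos
  unfold localFMPL
  rw [Real.log_mul (by positivity) (by positivity), Real.log_mul (by positivity) (by positivity),
    Real.log_mul (by positivity) (by positivity), Real.log_div h1.ne' h2.ne', Real.log_rpow hpi,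
    Real.log_rpow hn', Real.log_rpow hR]
  ring

/-- The logarithm is `1/c`-Lipschitz on `[c, ∞)`. -/
theorem abs_log_sub_log_le {a b c D : ℝ} (hc : 0 < c) (ha : c ≤ a) (hb : c ≤ b)
    (hD : |a - b| ≤ D) : |Real.log a - Real.log b| ≤ D / c := by
  have key : ∀ s t : ℝ, c ≤ s → c ≤ t → s - t ≤ D → Real.log s - Real.log t ≤ D / c := by
    intro s t hs ht hst
    have hs' := hc.trans_le hs
    have ht' := hc.trans_le ht
    rcases le_total s t with h | h
    · have hD0 : 0 ≤ D := (abs_nonneg _).trans hD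
      have := Real.log_le_log hs' h
      have : 0 ≤ D / c := by positivity
      linarith
    · rw [← Real.log_div hs'.ne' ht'.ne']
      refine (Real.log_le_sub_one_of_pos (by positivity)).trans ?_
      rw [div_sub_one ht'.ne']
      gcongr
      linarith
  rw [abs_le] at hD ⊢
  have h1 := key a b ha hb (by linarith)
  have h2 := key b a hb ha (by linarith)
  constructor <;> linarith

/-- If the scatter matrix is well conditioned and nearly annihilates, off the coordinate `j`, a
vector `w` with `w j = 1` supported on `insert j A`, then adding coordinates to `A` changes the log
likelihood by the penalty term alone, up to a bounded error. -/
theorem exists_abs_log_localFMPL_div_le {j : Fin p} {A A' : Finset (Fin p)} (hAA' : A ⊆ A')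
    (hj : j ∉ A') {w : Fin p → ℝ} (hwj : w j = 1) (hw : ∀ k, k ≠ j → k ∉ A → w k = 0) {c T : ℝ}
    (hc : 0 < c) :
    ∃ B : ℝ, ∀ n : ℕ, 2 ≤ n → ∀ x : ℕ → EuclideanSpace ℝ (Fin p),
      (∀ v, n * c * ∑ k, v k ^ 2 ≤ quad (scatter n x) v) →
      (∀ k, k ≠ j → |(scatter n x *ᵥ w) k| ≤ T * √n) →
      |Real.log (localFMPL n x j A / localFMPL n x j A')
        - ((A'.card : ℝ) - (A.card : ℝ)) / 2 * Real.log n| ≤ B := by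
  obtain ⟨a, ha⟩ := Nat.exists_eq_add_of_le (Finset.card_le_card hAA')
  obtain ⟨G, hG⟩ := exists_abs_log_Gamma_sub_le A.card a
  set C : ℝ := Real.log (Real.Gamma (((A'.card : ℝ) + 1) / 2))
    - Real.log (Real.Gamma (((A.card : ℝ) + 1) / 2)) with hC
  -- The last term: the ratios differ by at most `p T² / c`, their logarithms by that over `n c`,
  -- and the prefactor is at most `n / 2`.
  refine ⟨G + |C| + p * T ^ 2 / (2 * c ^ 2), fun n hn x hx hv => ?_⟩
  have hn' : (2 : ℝ) ≤ n := by exact_mod_cast hn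
  have hnpos : (0 : ℝ) < n := by linarith
  have hnc : 0 < n * c := by positivity
  have hS := scatter_posDef hnc hx
  have hV : ∑ k ∈ Finset.univ.erase j, (scatter n x *ᵥ w) k ^ 2 ≤ p * (T ^ 2 * n) := by
    have h1 : ∀ k ∈ Finset.univ.erase j, (scatter n x *ᵥ w) k ^ 2 ≤ T ^ 2 * n := by
      intro k hk
      have h2 := hv k (Finset.ne_of_mem_erase hk)
      have h3 := pow_le_pow_left₀ (abs_nonneg _) h2 2
      rwa [sq_abs, mul_pow, Real.sq_sqrt hnpos.le] at h3
    refine (Finset.sum_le_card_nsmul _ _ _ h1).trans ?_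
    rw [nsmul_eq_mul]
    gcongr
    exact_mod_cast (Finset.card_le_univ _).trans_eq (Fintype.card_fin p)
  obtain ⟨h1, h2, h3⟩ := minor_div_bounds hS hnc hx (fun h => hj (hAA' h)) hwj hw hV
  -- The same `w` is admissible for the larger set, so both ratios lie in one interval of length `p
  -- T² / c`.
  obtain ⟨h1', h2', h3'⟩ := minor_div_bounds hS hnc hx hj hwj
    (fun k hk hk' => hw k hk fun h => hk' (hAA' h)) hV
  have hn1 : 1 ≤ n := by omega
  have hR := hnc.trans_le h1
  have hR' := hnc.trans_le h1'
  rw [Real.log_div (localFMPL_pos hn1 hR).ne' (localFMPL_pos hn1 hR').ne', log_localFMPL hn1 hR,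
    log_localFMPL hn1 hR']
  set R := minor (scatter n x) (insert j A) / minor (scatter n x) A
  set R' := minor (scatter n x) (insert j A') / minor (scatter n x) A'
  have hlog := abs_log_sub_log_le hnc h1 h1' (D := p * (T ^ 2 * n) / (n * c))
    (abs_le.2 ⟨by linarith, by linarith⟩)
  have hlog' : |((n : ℝ) - 1) / 2 * (Real.log R - Real.log R')| ≤ p * T ^ 2 / (2 * c ^ 2) := by
    rw [abs_mul, abs_of_nonneg (by linarith : (0 : ℝ) ≤ ((n : ℝ) - 1) / 2)]
    have h5 : (p : ℝ) * (T ^ 2 * n) / (n * c) / (n * c) = p * T ^ 2 / c ^ 2 / n := by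
      field_simp
    have h6 : ((n : ℝ) - 1) / 2 ≤ n / 2 := by linarith
    rw [h5] at hlog
    refine (mul_le_mul h6 hlog (abs_nonneg _) (by positivity)).trans_eq ?_
    field_simp
  have hGn := hG n hn
  rw [← ha] at hGn
  have hcard : (A'.card : ℝ) = A.card + a := by exact_mod_cast ha
  have hfin := (abs_add_three _ _ _).trans (add_le_add (add_le_add hGn (le_refl |(-C)|)) hlog')
  rw [abs_neg] at hfin
  rw [← abs_neg]
  refine le_trans (le_of_eq ?_) hfin
  congr 1
  rw [hC, hcard]
  ring

end Likelihood

/-! ### The scatter matrix of a Gaussian sample -/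

section Gaussian

variable {p : ℕ} {K : Matrix (Fin p) (Fin p) ℝ}

theorem precision_eq_zero_of_notMem_markovBlanket (hK : K.PosDef) {j k : Fin p} (hkj : k ≠ j)
    (hk : k ∉ markovBlanket (multivariateGaussian 0 K⁻¹) j) : K j k = 0 := by
  have h : ¬ (condIndepGraph (multivariateGaussian 0 K⁻¹)).Adj j k := fun h => by
    classical exact hk (Finset.mem_filter.2 ⟨Finset.mem_univ _, h⟩)
  exact precision_eq_zero_of_pairCondIndep hK hkj
    (not_not.1 fun h' => h ⟨hkj.symm, fun h'' => h' h''.symm⟩)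

/-- Hölder with `1/4 + 1/4 = 1/2`; Chebyshev for products of coordinates needs fourth moments. -/
theorem memLp_coord_mul {S : Matrix (Fin p) (Fin p) ℝ} {f : EuclideanSpace ℝ (Fin p) → ℝ}
    (hf : MemLp f 4 (multivariateGaussian 0 S)) (k : Fin p) :
    MemLp (fun x => x k * f x) 2 (multivariateGaussian 0 S) := by
  have : ENNReal.HolderTriple 4 4 2 := ⟨by
    rw [show (4 : ℝ≥0∞) = 2 * 2 by norm_num,
      ENNReal.mul_inv (Or.inl (by simp)) (Or.inl (by simp)), ← mul_add, ENNReal.inv_two_add_inv_two,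
      mul_one]⟩
  exact hf.mul (memLp_coord S k 4 (by simp))

/-- With high probability the scatter matrix is well conditioned, and it nearly annihilates the
normalised `j`-th row of the precision matrix off the coordinate `j`. -/
theorem exists_measure_scatter_le (hK : K.PosDef) {Ω : Type*} [MeasurableSpace Ω] {P : Measure Ω}
    [IsProbabilityMeasure P] {X : ℕ → Ω → EuclideanSpace ℝ (Fin p)}
    (hlaw : ∀ i, HasLaw (X i) (multivariateGaussian 0 K⁻¹) P) (hindep : iIndepFun X P) (j : Fin p) :
    ∃ c : ℝ, 0 < c ∧ ∀ ε : ℝ≥0∞, 0 < ε → ∃ T : ℝ, ∀ᶠ n : ℕ in atTop,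
      P {ω | ¬ ((∀ v, n * c * ∑ k, v k ^ 2 ≤ quad (scatter n fun i => X i ω) v) ∧
        ∀ k, k ≠ j →
          |(scatter n (fun i => X i ω) *ᵥ fun l => K j l / K j j) k| ≤ T * √n)} ≤ ε := by
  obtain ⟨c, hc, hquad⟩ := exists_le_quad hK.inv
  set ν := multivariateGaussian (0 : EuclideanSpace ℝ (Fin p)) K⁻¹
  let w : Fin p → ℝ := fun l => K j l / K j j
  let f : EuclideanSpace ℝ (Fin p) → ℝ := fun x => ∑ l, w l * x l
  have hf : f = fun x => (K j j)⁻¹ * rowForm K j x := by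
    ext x
    simp only [f, w, rowForm, Finset.mul_sum]
    refine Finset.sum_congr rfl fun l _ => ?_
    ring
  have hf4 : MemLp f 4 ν := by
    rw [hf]
    exact (memLp_rowForm _ _ _ 4 (by simp)).const_mul _
  -- One finite family covers both requirements: its sums are the entries of `S - n K⁻¹` and the
  -- coordinates of `S w` off `j`.
  let g : (Fin p × Fin p) ⊕ {k : Fin p // k ≠ j} → EuclideanSpace ℝ (Fin p) → ℝ :=
    Sum.elim (fun a x => x a.1 * x a.2 - K⁻¹ a.1 a.2) fun k x => x k * f x
  have hg : ∀ i, ∀ ε : ℝ≥0∞, 0 < ε → ∃ T : ℝ, ∀ n : ℕ, 1 ≤ n →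
      P {ω | T * √n ≤ |∑ m ∈ Finset.range n, g i (X m ω)|} ≤ ε := by
    rintro (⟨k, l⟩ | ⟨k, hk⟩) ε hε
    · refine exists_measure_sqrt_le_abs_sum_le hlaw hindep (g := fun x => x k * x l - K⁻¹ k l)
        (by fun_prop) ((memLp_coord_mul (memLp_coord _ l 4 (by simp)) k).sub (memLp_const _)) ?_ hε
      have hint : Integrable (fun x : EuclideanSpace ℝ (Fin p) => x k * x l) ν :=
        integrable_mul_of_memLp_two (memLp_coord _ k 2 (by simp)) (memLp_coord _ l 2 (by simp))
      rw [integral_sub hint (integrable_const _), integral_coord_mul_coord hK.inv.posSemidef]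
      simp
    · refine exists_measure_sqrt_le_abs_sum_le hlaw hindep (g := fun x => x k * f x)
        (by fun_prop) (memLp_coord_mul hf4 k) ?_ hε
      have h := integral_rowForm_mul_coord hK j k
      rw [if_neg hk.symm] at h
      simp only [hf]
      simp_rw [fun x : EuclideanSpace ℝ (Fin p) =>
        show x k * ((K j j)⁻¹ * rowForm K j x) = (K j j)⁻¹ * (rowForm K j x * x k) by ring]
      rw [integral_const_mul, h, mul_zero]
  refine ⟨c / 2, by positivity, fun ε hε => ?_⟩
  obtain ⟨T, hT0, hT⟩ := exists_uniform_measure_sqrt_le_abs_le hg hε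
  refine ⟨T, ?_⟩
  -- Entrywise error `n δ` costs at most half of the constant `c`; it holds once `√n ≥ T / δ`, since
  -- then `T √n ≤ n δ`.
  set δ : ℝ := c / (2 * (p + 1)) with hδ
  have hδ0 : 0 < δ := by positivity
  have hpδ : c / 2 ≤ c - p * δ := by
    have : p * δ = c / 2 * (p / (p + 1)) := by
      rw [hδ]
      field_simp
    have h2 : (p : ℝ) / (p + 1) ≤ 1 := by
      rw [div_le_one (by positivity)]
      linarith
    nlinarith
  have hlarge : ∀ᶠ n : ℕ in atTop, T / δ ≤ √(n : ℝ) :=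
    (Real.tendsto_sqrt_atTop.comp tendsto_natCast_atTop_atTop).eventually_ge_atTop _
  filter_upwards [hlarge, eventually_ge_atTop 1] with n hn hn1
  refine (measure_mono fun ω hω => ?_).trans (hT n hn1)
  by_contra hcon
  simp only [Set.mem_ofPred_eq, not_exists, not_le] at hcon
  refine hω ⟨?_, fun k hk => ?_⟩
  · have hTn : T * √n ≤ n * δ := by
      rw [div_le_iff₀ hδ0] at hn
      nlinarith [Real.sqrt_nonneg n, Real.mul_self_sqrt (Nat.cast_nonneg (α := ℝ) n)]
    have hS : ∀ v, n * c * ∑ k, v k ^ 2 ≤ quad ((n : ℝ) • K⁻¹) v := by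
      intro v
      have : quad ((n : ℝ) • K⁻¹) v = n * quad K⁻¹ v := by
        simp [quad, Matrix.smul_mulVec, dotProduct_smul]
      rw [this, mul_assoc]
      gcongr
      exact hquad v
    have hent : ∀ k l, |scatter n (fun i => X i ω) k l - ((n : ℝ) • K⁻¹) k l| ≤ n * δ := by
      intro k l
      refine le_trans (le_of_eq ?_) ((hcon (Sum.inl (k, l))).le.trans hTn)
      simp [g, scatter_apply, Finset.sum_sub_distrib]
    intro v
    refine le_trans ?_ (le_quad_of_abs_sub_le hS hent v)
    have : 0 ≤ ∑ k, v k ^ 2 := Finset.sum_nonneg fun k _ => sq_nonneg _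
    refine mul_le_mul_of_nonneg_right ?_ this
    nlinarith [Nat.cast_nonneg (α := ℝ) n]
  · rw [scatter_mulVec_apply]
    exact (hcon (Sum.inr ⟨k, hk⟩)).le

end Gaussian

end GGM

end

/-! ### The overestimation theorem -/

theorem lemma1 {p : ℕ} (K : Matrix (Fin p) (Fin p) ℝ) (hK : K.PosDef)
    {Ω : Type*} [MeasurableSpace Ω] (P : Measure Ω) [IsProbabilityMeasure P]
    (X : ℕ → Ω → EuclideanSpace ℝ (Fin p))
    (hlaw : ∀ i, HasLaw (X i) (multivariateGaussian 0 K⁻¹) P)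
    (hindep : iIndepFun X P)
    (j : Fin p) (mb : Finset (Fin p)) (hj : j ∉ mb)
    (hmb : GGM.markovBlanket (multivariateGaussian 0 K⁻¹) j ⊂ mb) :
    GGM.TendstoInfInProbability P (fun n ω =>
        Real.log (GGM.localFMPL n (fun i => X i ω) j
            (GGM.markovBlanket (multivariateGaussian 0 K⁻¹) j)
          / GGM.localFMPL n (fun i => X i ω) j mb)) ∧
      GGM.BoundedInProbability P (fun n ω =>
        Real.log (GGM.localFMPL n (fun i => X i ω) j
            (GGM.markovBlanket (multivariateGaussian 0 K⁻¹) j)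
          / GGM.localFMPL n (fun i => X i ω) j mb)
        - ((mb.card : ℝ) - ((GGM.markovBlanket (multivariateGaussian 0 K⁻¹) j).card : ℝ)) / 2
          * Real.log n) := by
  set A := GGM.markovBlanket (multivariateGaussian 0 K⁻¹) j with hA
  have hbdd : GGM.BoundedInProbability P (fun n ω =>
      Real.log (GGM.localFMPL n (fun i => X i ω) j A / GGM.localFMPL n (fun i => X i ω) j mb)
        - ((mb.card : ℝ) - (A.card : ℝ)) / 2 * Real.log n) := by
    obtain ⟨c, hc, h⟩ := GGM.exists_measure_scatter_le hK hlaw hindep j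
    intro ε hε
    obtain ⟨T, hT⟩ := h ε hε
    obtain ⟨B, hB⟩ := GGM.exists_abs_log_localFMPL_div_le hmb.subset hj (c := c) (T := T)
      (w := fun l => K j l / K j j) (div_self hK.diag_pos.ne')
      (fun k hk hkA => by
        rw [GGM.precision_eq_zero_of_notMem_markovBlanket hK hk hkA, zero_div]) hc
    refine ⟨B, ?_⟩
    filter_upwards [hT, eventually_ge_atTop 2] with n hn hn2
    -- On the good event the deterministic bound `B` holds, so exceeding it lies in the bad event.
    refine (measure_mono fun ω hω hgood => ?_).trans hn
    exact (not_lt.2 (hB n hn2 _ hgood.1 hgood.2)) hω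
  refine ⟨GGM.tendstoInfInProbability_of_boundedInProbability_sub ?_ hbdd, hbdd⟩
  have hcard : (A.card : ℝ) < mb.card := by exact_mod_cast Finset.card_lt_card hmb
  exact (Real.tendsto_log_atTop.comp tendsto_natCast_atTop_atTop).const_mul_atTop (by linarith)
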